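/- Let $k$ be a field with a (possibly trivial) valuation $v\colon k\to\mathbb{R}\cup\{\infty\}$, let $H$ be a finitely generated abelian group with $\mathrm{rank}_{\mathbb{Z}}H\ge 1$, and let $I\subsetneq kH$ be a proper ideal of the group ring. Here a valuation on a commutative ring $A$ is a map $w\colon A\to\mathbb{R}\cup\{\infty\}$ with $w(ab)=w(a)+w(b)$, $w(a+b)\ge\min\{w(a),w(b)\}$, $w(0)=\infty$ and $w(1)=0$ (nonzero elements may have value $\infty$). Let $\kappa\colon kH\to kH/I$ be the quotient map and put $$\Delta^v_I(H)=\{\chi\in\mathrm{Hom}(H,\mathbb{R}) \mid \text{there is a valuation } w \text{ on } kH/I \text{ with } (w\circ\kappa)|_k=v \text{ and } (w\circ\kappa)|_H=\chi\}.$$ For an ideal $J\subseteq k\mathbb{Z}^N=k[x_1^{\pm1},\dots,x_N^{\pm1}]$, let $\mathrm{Trop}_{k,v}(J)\subseteq\mathbb{R}^N$ be the set of all $\mathbf{w}\in\mathbb{R}^N$ such that for every nonzero $f=\sum_{\mathbf{u}}a_{\mathbf{u}}x^{\mathbf{u}}\in J$ the minimum $\min\{v(a_{\mathbf{u}})+\mathbf{u}\cdot\mathbf{w}\mid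 a_{\mathbf{u}}\ne0\}$ is achieved at least twice. For $H$, choose an isomorphism $H\cong\mathbb{Z}^n\oplus\mathbb{Z}/d_1\oplus\cdots\oplus\mathbb{Z}/d_m$ with all $d_j\ge1$, and let $\psi\colon\mathbb{Z}^{n+m}\to H$ be the resulting epimorphism, $\psi^*\colon\mathrm{Hom}(H,\mathbb{R})\hookrightarrow\mathrm{Hom}(\mathbb{Z}^{n+m},\mathbb{R})=\mathbb{R}^{n+m}$ the induced embedding, and $\tilde I\subseteq k\mathbb{Z}^{n+m}$ the preimage of $I$ under the induced ring epimorphism $k\mathbb{Z}^{n+m}\to kH$. Define $$\mathrm{Trop}_{k,v}(I)=(\psi^*)^{-1}\bigl(\mathrm{Trop}_{k,v}(\tilde I)\bigr)\subseteq\mathrm{Hom}(H,\mathbb{R}).$$ Then, for every choice of such an isomorphism, $$\Delta^v_I(H)=\mathrm{Trop}_{k,v}(I).$$ -/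

import Mathlib

noncomputable section

namespace TropicalBieriGroves

/-- The characters `χ : H → ℝ` induced by valuations on `kH / I` extending `v`: there is a
valuation `w : kH / I → ℝ ∪ {∞}` which restricts to `v` along `k → kH → kH / I` and to `χ` along
`H → kH → kH / I`. The group `H` is written additively, so `h : H` is the monomial
`AddMonoidAlgebra.single h 1` of the group ring. -/
def bieriGrovesSet {k : Type*} [Field k] {H : Type*} [AddCommGroup H]
    (v : AddValuation k (WithTop ℝ)) (I : Ideal (AddMonoidAlgebra k H)) : Set (H →+ ℝ) :=
  {χ | ∃ w : AddValuation (AddMonoidAlgebra k H ⧸ I) (WithTop ℝ),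
    (∀ a : k, w (Ideal.Quotient.mk I (AddMonoidAlgebra.single 0 a)) = v a) ∧
    (∀ h : H, w (Ideal.Quotient.mk I (AddMonoidAlgebra.single h 1)) = ((χ h : ℝ) : WithTop ℝ))}

/-- Laurent polynomials over `k` in variables indexed by `ι`: the group ring of `ℤ^ι`. -/
abbrev Laurent (k : Type*) [Field k] (ι : Type*) : Type _ := AddMonoidAlgebra k (ι → ℤ)

/-- The quantity `v(a_u) + u ⋅ w` attached to the exponent `u` of `f = ∑ a_u x^u`. -/
def tropTerm {k : Type*} [Field k] {ι : Type*} [Fintype ι] (v : AddValuation k (WithTop ℝ))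
    (f : Laurent k ι) (w : ι → ℝ) (u : ι → ℤ) : WithTop ℝ :=
  v (f.coeff u) + ((∑ i, (u i : ℝ) * w i : ℝ) : WithTop ℝ)

/-- The tropical polynomial `trop(f)(w) = min {v(a_u) + u ⋅ w | a_u ≠ 0}`. -/
def tropPoly {k : Type*} [Field k] {ι : Type*} [Fintype ι] (v : AddValuation k (WithTop ℝ))
    (f : Laurent k ι) (w : ι → ℝ) : WithTop ℝ :=
  f.coeff.support.inf (tropTerm v f w)

/-- The tropical hypersurface of `f`: the points `w` at which the minimum defining `trop(f)(w)` is
achieved at least twice. -/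
def tropHypersurface {k : Type*} [Field k] {ι : Type*} [Fintype ι]
    (v : AddValuation k (WithTop ℝ)) (f : Laurent k ι) : Set (ι → ℝ) :=
  {w | ∃ u₁ ∈ f.coeff.support, ∃ u₂ ∈ f.coeff.support, u₁ ≠ u₂ ∧
    tropTerm v f w u₁ = tropPoly v f w ∧ tropTerm v f w u₂ = tropPoly v f w}

/-- The tropical variety of an ideal of Laurent polynomials: the intersection of the tropical
hypersurfaces of its nonzero elements. -/
def tropVarietyLaurent {k : Type*} [Field k] {ι : Type*} [Fintype ι]
    (v : AddValuation k (WithTop ℝ)) (J : Ideal (Laurent k ι)) : Set (ι → ℝ) :=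
  ⋂ f ∈ J, ⋂ (_ : f ≠ 0), tropHypersurface v f

/-- An isomorphism `H ≅ ℤ^n ⊕ ℤ/d_1 ⊕ ⋯ ⊕ ℤ/d_m` with all `d_j ≥ 1`. -/
structure CyclicDecomposition (H : Type*) [AddCommGroup H] where
  n : ℕ
  m : ℕ
  d : Fin m → ℕ
  d_pos : ∀ j, 0 < d j
  equiv : H ≃+ (Fin n → ℤ) × (∀ j : Fin m, ZMod (d j))

/-- Every finitely generated abelian group has such a decomposition. -/
theorem CyclicDecomposition.nonempty (H : Type*) [AddCommGroup H] [AddGroup.FG H] :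
    Nonempty (CyclicDecomposition H) := by
  classical
  obtain ⟨n, ι, _, p, hp, e, ⟨f⟩⟩ := AddCommGroup.equiv_free_prod_directSum_zmod H
  let σ := Fintype.equivFin ι
  refine ⟨⟨n, Fintype.card ι, fun j => p (σ.symm j) ^ e (σ.symm j),
    fun j => pow_pos (hp _).pos _, f.trans ?_⟩⟩
  refine AddEquiv.prodCongr (Finsupp.linearEquivFunOnFinite ℤ ℤ (Fin n)).toAddEquiv ?_
  exact (DirectSum.addEquivProd (fun i : ι => ZMod (p i ^ e i))).trans
    (LinearEquiv.piCongrLeft' ℤ (fun i : ι => ZMod (p i ^ e i)) σ).toAddEquiv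

namespace CyclicDecomposition

variable {H : Type*} [AddCommGroup H]

/-- The epimorphism `ψ : ℤ^(n+m) → H` given by a decomposition: reduce the `j`-th of the last `m`
coordinates modulo `d_j`. -/
def psi (D : CyclicDecomposition H) : (Fin D.n ⊕ Fin D.m → ℤ) →+ H where
  toFun u := D.equiv.symm (fun i => u (Sum.inl i), fun j => (u (Sum.inr j) : ZMod (D.d j)))
  map_zero' := by
    rw [← map_zero D.equiv.symm]
    congr 1
    ext <;> simp
  map_add' u u' := by
    rw [← map_add D.equiv.symm]
    congr 1
    ext <;> simp

/-- The embedding `ψ^* : Hom(H, ℝ) → Hom(ℤ^(n+m), ℝ) = ℝ^(n+m)`, a homomorphism on `ℤ^(n+m)` being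
identified with the vector of its values at the standard basis. -/
def psiStar (D : CyclicDecomposition H) (χ : H →+ ℝ) : Fin D.n ⊕ Fin D.m → ℝ :=
  fun i => χ (D.psi (Pi.single i 1))

end CyclicDecomposition

/-- The tropical variety of an ideal `I` of `kH`, computed with a decomposition of `H`: it is
`(ψ^*)⁻¹ Trop(Ĩ)`, where `Ĩ` is the preimage of `I` under the epimorphism `kℤ^(n+m) → kH` induced
by `ψ`, i.e. the ideal containing the kernel of it with `kℤ^(n+m) / Ĩ ≅ kH / I`. -/
def tropVariety {k : Type*} [Field k] {H : Type*} [AddCommGroup H] (D : CyclicDecomposition H)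
    (v : AddValuation k (WithTop ℝ)) (I : Ideal (AddMonoidAlgebra k H)) : Set (H →+ ℝ) :=
  {χ | D.psiStar χ ∈
    tropVarietyLaurent v (I.comap (AddMonoidAlgebra.mapDomainRingHom k D.psi))}

end TropicalBieriGroves

end

/-!
If `w` is a valuation on `kH / I` inducing `χ` and `f = ∑ a_u x^u` lies in `I`, then the classes of
the terms of `f` sum to zero and have finite values `v(a_u) + χ(u)`, so the smallest of these
values occurs twice.

Conversely, exponentiating the weighted minimum `min (v(a_u) + χ(u))` gives a nonarchimedean
seminorm on `kH`. If `1 - f ∈ I` and all terms of `f` had positive value, then the minimum of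
`1 - f` would be attained at the constant term only. Under the tropical condition `1` therefore
keeps norm `1` in `kH / I`, and a minimal unital nonarchimedean seminorm `p` below the quotient
seminorm exists by Zorn's lemma. Minimality forces `p` to be multiplicative: it is fixed by
smoothing `x ↦ lim p(xⁿ)^(1/n)` and by `x ↦ lim p(x cⁿ) / p(c)ⁿ`. The quotient seminorms of a term
`a x^u` and of its inverse are at most `exp (-(v(a) + χ(u)))` and its reciprocal, so `p` takes
exactly this value at `a x^u`, and `-log p` is the required valuation.
-/

noncomputable section

namespace TropicalBieriGroves

section RingSeminorm

variable {R : Type*} [CommRing R]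

instance : PartialOrder (RingSeminorm R) := PartialOrder.lift (⇑) DFunLike.coe_injective

theorem ringSeminorm_bddBelow_range {ι : Type*} (p : ι → RingSeminorm R) (x : R) :
    BddBelow (Set.range fun i ↦ p i x) :=
  ⟨0, Set.forall_mem_range.2 fun i ↦ apply_nonneg (p i) x⟩

/-- The pointwise infimum of a downward directed family of ring seminorms. -/
def directedInf {ι : Type*} [Nonempty ι] (p : ι → RingSeminorm R) (hp : Directed (· ≥ ·) p) :
    RingSeminorm R where
  toFun x := ⨅ i, p i x
  map_zero' := by simp
  neg' x := by simp
  add_le' x y := by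
    refine le_ciInf_add_ciInf fun i j ↦ ?_
    obtain ⟨l, hli, hlj⟩ := hp i j
    exact (ciInf_le (ringSeminorm_bddBelow_range p _) l).trans <|
      (map_add_le_add (p l) x y).trans (add_le_add (hli x) (hlj y))
  mul_le' x y := by
    rw [Real.iInf_mul_of_nonneg (Real.iInf_nonneg fun i ↦ apply_nonneg (p i) y)]
    refine le_ciInf fun i ↦ ?_
    rw [Real.mul_iInf_of_nonneg (apply_nonneg (p i) x)]
    refine le_ciInf fun j ↦ ?_
    obtain ⟨l, hli, hlj⟩ := hp i j
    exact (ciInf_le (ringSeminorm_bddBelow_range p _) l).trans <|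
      (map_mul_le_mul (p l) x y).trans <|
        mul_le_mul (hli x) (hlj y) (apply_nonneg _ _) (apply_nonneg _ _)

section DirectedInf

variable {ι : Type*} [Nonempty ι] {p : ι → RingSeminorm R} {hp : Directed (· ≥ ·) p}

theorem directedInf_apply (x : R) : directedInf p hp x = ⨅ i, p i x := rfl

theorem directedInf_le (i : ι) : directedInf p hp ≤ p i :=
  fun x ↦ ciInf_le (ringSeminorm_bddBelow_range p x) i

theorem isNonarchimedean_directedInf (hna : ∀ i, IsNonarchimedean (p i)) :
    IsNonarchimedean (directedInf p hp) := by
  intro x y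
  by_contra! hlt
  obtain ⟨i, hi⟩ := exists_lt_of_ciInf_lt ((le_max_left _ _).trans_lt hlt)
  obtain ⟨j, hj⟩ := exists_lt_of_ciInf_lt ((le_max_right _ _).trans_lt hlt)
  obtain ⟨l, hli, hlj⟩ := hp i j
  exact ((hna l x y).trans_lt (max_lt ((hli x).trans_lt hi) ((hlj y).trans_lt hj))).not_ge
    (directedInf_le l (x + y))

end DirectedInf

/-- The quotient seminorm `x ↦ inf {p f | f ↦ x}` on `R ⧸ I`, taken from the quotient norm of the
seminormed ring `(R, p)`. -/
def quotientSeminorm (p : RingSeminorm R) (I : Ideal R) : RingSeminorm (R ⧸ I) :=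
  letI : SeminormedCommRing R := { p.toSeminormedRing with mul_comm := mul_comm }
  normRingSeminorm (R ⧸ I)

section Quotient

variable {p : RingSeminorm R} {I : Ideal R} {x : R ⧸ I} {r : ℝ}

theorem quotientSeminorm_lt_iff :
    quotientSeminorm p I x < r ↔ ∃ f, Ideal.Quotient.mk I f = x ∧ p f < r :=
  let _ : SeminormedCommRing R := { p.toSeminormedRing with mul_comm := mul_comm }
  QuotientAddGroup.norm_lt_iff

theorem le_quotientSeminorm_iff :
    r ≤ quotientSeminorm p I x ↔ ∀ f, Ideal.Quotient.mk I f = x → r ≤ p f :=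
  let _ : SeminormedCommRing R := { p.toSeminormedRing with mul_comm := mul_comm }
  QuotientAddGroup.le_norm_iff

theorem quotientSeminorm_mk_le (f : R) : quotientSeminorm p I (Ideal.Quotient.mk I f) ≤ p f :=
  le_quotientSeminorm_iff.1 le_rfl f rfl

theorem isNonarchimedean_quotientSeminorm (hp : IsNonarchimedean p) :
    IsNonarchimedean (quotientSeminorm p I) := by
  intro x y
  by_contra! hlt
  obtain ⟨f, rfl, hf⟩ := quotientSeminorm_lt_iff.1 ((le_max_left _ _).trans_lt hlt)
  obtain ⟨g, rfl, hg⟩ := quotientSeminorm_lt_iff.1 ((le_max_right _ _).trans_lt hlt)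
  exact ((hp f g).trans_lt (max_lt hf hg)).not_ge (quotientSeminorm_mk_le (f + g))

end Quotient

/-- A ring seminorm `p` that is nonarchimedean and satisfies `p 1 = 1`. -/
structure IsUnitalNonarchimedean (p : RingSeminorm R) : Prop where
  map_one : p 1 = 1
  isNonarchimedean : IsNonarchimedean p

theorem exists_minimal_isUnitalNonarchimedean_le {q : RingSeminorm R}
    (hq : IsUnitalNonarchimedean q) : ∃ p ≤ q, Minimal IsUnitalNonarchimedean p := by
  refine zorn_le_nonempty₀ (α := (RingSeminorm R)ᵒᵈ) {p | IsUnitalNonarchimedean p}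
    (fun c hc hchain y hy ↦ ?_) q hq
  have : Nonempty c := ⟨⟨y, hy⟩⟩
  let F (p : c) : RingSeminorm R := OrderDual.ofDual p.1
  have hF (p : c) : IsUnitalNonarchimedean (F p) := hc p.2
  have hdir : Directed (· ≥ ·) F := hchain.directedOn.directed_val
  refine ⟨directedInf F hdir, ⟨?_, ?_⟩, fun p hp ↦ ?_⟩
  · simp only [directedInf_apply, fun p ↦ (hF p).map_one, ciInf_const]
  · exact isNonarchimedean_directedInf fun p ↦ (hF p).isNonarchimedean
  · exact directedInf_le (hp := hdir) ⟨p, hp⟩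

section Minimal

variable {p : RingSeminorm R}

theorem isPowMul_of_minimal (hp : Minimal IsUnitalNonarchimedean p) : IsPowMul p := by
  obtain ⟨hone, hna⟩ := hp.prop
  let s := smoothingSeminorm p hone.le hna
  have hs : IsUnitalNonarchimedean s :=
    ⟨(smoothingFun_of_powMul p hone.le fun n _ ↦ by simp only [one_pow, hone]).trans hone,
      isNonarchimedean_smoothingFun p hone.le hna⟩
  have hsp : s = p := hp.eq_of_le hs (smoothingFun_le_self p)
  exact hsp ▸ isPowMul_smoothingFun p hone.le

theorem map_mul_of_minimal (hp : Minimal IsUnitalNonarchimedean p) (x y : R) :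
    p (x * y) = p x * p y := by
  obtain ⟨hone, hna⟩ := hp.prop
  have hpow : IsPowMul p := isPowMul_of_minimal hp
  by_cases hx : p x = 0
  · refine le_antisymm (map_mul_le_mul p x y) ?_
    rw [hx, zero_mul]
    exact apply_nonneg p _
  let s := seminormFromConst hone.le hx hpow
  have hs : IsUnitalNonarchimedean s :=
    ⟨seminormFromConst_one hone.le hx hpow, seminormFromConst_isNonarchimedean hone.le hx hpow hna⟩
  have hsp : s = p := hp.eq_of_le hs (seminormFromConst_le_seminorm hone.le hx hpow)
  exact hsp ▸ seminormFromConst_const_mul hone.le hx hpow y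

end Minimal

theorem exists_mulRingSeminorm_le {q : RingSeminorm R} (hq : IsUnitalNonarchimedean q) :
    ∃ p : MulRingSeminorm R, IsNonarchimedean p ∧ ∀ x, p x ≤ q x := by
  obtain ⟨p, hpq, hp⟩ := exists_minimal_isUnitalNonarchimedean_le hq
  exact ⟨{ p with map_one' := hp.prop.map_one, map_mul' := map_mul_of_minimal hp },
    hp.prop.isNonarchimedean, hpq⟩

theorem mulRingSeminorm_eq_of_le_of_mul_eq_one {p : MulRingSeminorm R} {x y : R} {a b : ℝ}
    (hxy : x * y = 1) (hx : p x ≤ a) (hy : p y ≤ b) (hab : a * b = 1) : p x = a := by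
  have hpxy : p x * p y = 1 := by rw [← map_mul, hxy, map_one]
  refine hx.antisymm ?_
  calc a = a * (p x * p y) := by rw [hpxy, mul_one]
    _ ≤ a * (p x * b) := by
      have := (apply_nonneg p x).trans hx
      have := apply_nonneg p x
      gcongr
    _ = p x := by rw [mul_left_comm, hab, mul_one]

end RingSeminorm

section ExpNeg

/-- The order-reversing map `t ↦ exp (-t)` from `ℝ ∪ {∞}` to `ℝ`, with `∞ ↦ 0`. -/
def expNeg : WithTop ℝ → ℝ
  | ⊤ => 0
  | (t : ℝ) => Real.exp (-t)

@[simp] theorem expNeg_top : expNeg ⊤ = 0 := rfl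

@[simp] theorem expNeg_coe (t : ℝ) : expNeg t = Real.exp (-t) := rfl

@[simp] theorem expNeg_zero : expNeg 0 = 1 := by
  rw [← WithTop.coe_zero, expNeg_coe, neg_zero, Real.exp_zero]

theorem expNeg_nonneg (s : WithTop ℝ) : 0 ≤ expNeg s := by
  cases s <;> simp [Real.exp_nonneg]

theorem expNeg_add (s t : WithTop ℝ) : expNeg (s + t) = expNeg s * expNeg t := by
  cases s <;> cases t <;> simp [← WithTop.coe_add, Real.exp_add, mul_comm]

theorem expNeg_strictAnti : StrictAnti expNeg := by
  intro s t hst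
  cases s <;> cases t <;> simp_all [Real.exp_pos]

/-- The map `r ↦ -log r` from the nonnegative reals to `ℝ ∪ {∞}`, with `0 ↦ ∞`. At negative `r` it
takes the meaningless value `-log |r|`. -/
def negLog (r : ℝ) : WithTop ℝ := if r = 0 then ⊤ else (-Real.log r : ℝ)

theorem negLog_expNeg (s : WithTop ℝ) : negLog (expNeg s) = s := by
  cases s <;> simp [negLog, Real.exp_ne_zero]

theorem expNeg_negLog {r : ℝ} (hr : 0 ≤ r) : expNeg (negLog r) = r := by
  rcases hr.eq_or_lt with rfl | hr
  · simp [negLog]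
  · rw [negLog, if_neg hr.ne', expNeg_coe, neg_neg, Real.exp_log hr]

end ExpNeg

section Valuation

/-- The valuation `-log p` of a multiplicative nonarchimedean seminorm `p`. -/
def negLogValuation {R : Type*} [CommRing R] (p : MulRingSeminorm R) (hp : IsNonarchimedean p) :
    AddValuation R (WithTop ℝ) :=
  AddValuation.of (fun x ↦ negLog (p x)) (by simp [negLog]) (by simp [negLog])
    (fun x y ↦ by
      rw [← expNeg_strictAnti.le_iff_ge, expNeg_strictAnti.antitone.map_min]
      simpa only [expNeg_negLog (apply_nonneg p _)] using hp x y)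
    (fun x y ↦ by
      apply expNeg_strictAnti.injective
      rw [map_mul, expNeg_add, expNeg_negLog (apply_nonneg p x), expNeg_negLog (apply_nonneg p y),
        expNeg_negLog (mul_nonneg (apply_nonneg p x) (apply_nonneg p y))])

theorem exists_ne_map_eq_of_sum_eq_zero {R Γ ι : Type*} [Ring R]
    [LinearOrderedAddCommMonoidWithTop Γ] (w : AddValuation R Γ) {s : Finset ι} {F : ι → R}
    (hsum : ∑ i ∈ s, F i = 0) {i : ι} (hi : i ∈ s) (hmin : ∀ j ∈ s, w (F i) ≤ w (F j))
    (htop : w (F i) ≠ ⊤) : ∃ j ∈ s, j ≠ i ∧ w (F j) = w (F i) := by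
  classical
  by_contra! hne
  have hlt : ∀ j ∈ s \ {i}, w (F i) < w (F j) := by
    intro j hj
    rw [Finset.mem_sdiff, Finset.mem_singleton] at hj
    exact (hmin j hj.1).lt_of_ne' (hne j hj.1 hj.2)
  have hval : w (∑ j ∈ s, F j) = w (F i) := Valuation.map_sum_eq_of_lt w.toValuation hi hlt
  exact htop (by rw [← hval, hsum, w.map_zero])

end Valuation

section GaussValue

variable {A : Type*} [CommRing A] {G : Type*} [AddCommMonoid G]

/-- The value `v(a_h) + χ(h)` of the term of `f = ∑ a_h h` at `h`. -/
def gaussTerm (v : AddValuation A (WithTop ℝ)) (χ : G →+ ℝ) (f : AddMonoidAlgebra A G) (h : G) :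
    WithTop ℝ :=
  v (f.coeff h) + (χ h : ℝ)

/-- The Gauss value `min {v(a_h) + χ(h) | a_h ≠ 0}` of `f = ∑ a_h h`, which is `∞` for `f = 0`. -/
def gaussValue (v : AddValuation A (WithTop ℝ)) (χ : G →+ ℝ) (f : AddMonoidAlgebra A G) :
    WithTop ℝ :=
  f.coeff.support.inf (gaussTerm v χ f)

variable {v : AddValuation A (WithTop ℝ)} {χ : G →+ ℝ} {f g : AddMonoidAlgebra A G}

theorem le_gaussValue_iff {t : WithTop ℝ} :
    t ≤ gaussValue v χ f ↔ ∀ h, t ≤ gaussTerm v χ f h := by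
  refine Finset.le_inf_iff.trans (forall_congr' fun h ↦ ⟨fun ht ↦ ?_, fun ht _ ↦ ht⟩)
  by_cases hh : f.coeff h = 0
  · simp [gaussTerm, hh]
  · exact ht (Finsupp.mem_support_iff.2 hh)

theorem gaussValue_le (h : G) : gaussValue v χ f ≤ gaussTerm v χ f h :=
  le_gaussValue_iff.1 le_rfl h

theorem gaussValue_zero : gaussValue v χ (0 : AddMonoidAlgebra A G) = ⊤ := rfl

theorem gaussValue_single (h : G) (a : A) :
    gaussValue v χ (AddMonoidAlgebra.single h a) = v a + (χ h : ℝ) := by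
  classical
  refine le_antisymm ?_ (le_gaussValue_iff.2 fun i ↦ ?_)
  · simpa [gaussTerm] using gaussValue_le (v := v) (χ := χ) (f := AddMonoidAlgebra.single h a) h
  · rcases eq_or_ne h i with rfl | hi <;>
      simp [gaussTerm, AddMonoidAlgebra.coeff_single, *]

theorem gaussValue_one : gaussValue v χ (1 : AddMonoidAlgebra A G) = 0 := by
  simp [AddMonoidAlgebra.one_def, gaussValue_single]

theorem gaussValue_neg : gaussValue v χ (-f) = gaussValue v χ f := by
  have hterm : gaussTerm v χ (-f) = gaussTerm v χ f := by ext h : 1; simp [gaussTerm]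
  rw [gaussValue, hterm, AddMonoidAlgebra.coeff_neg, Finsupp.support_neg, gaussValue]

theorem min_le_gaussValue_add :
    min (gaussValue v χ f) (gaussValue v χ g) ≤ gaussValue v χ (f + g) := by
  refine le_gaussValue_iff.2 fun h ↦ ?_
  calc min (gaussValue v χ f) (gaussValue v χ g)
      ≤ min (gaussTerm v χ f h) (gaussTerm v χ g h) :=
        min_le_min (gaussValue_le h) (gaussValue_le h)
    _ = min (v (f.coeff h)) (v (g.coeff h)) + (χ h : ℝ) := min_add_add_right _ _ _
    _ ≤ gaussTerm v χ (f + g) h := by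
        rw [gaussTerm, AddMonoidAlgebra.coeff_add, Finsupp.add_apply]
        gcongr
        exact v.map_add _ _

theorem le_gaussValue_sum {ι : Type*} {s : Finset ι} {F : ι → AddMonoidAlgebra A G}
    {t : WithTop ℝ} (ht : ∀ i ∈ s, t ≤ gaussValue v χ (F i)) :
    t ≤ gaussValue v χ (∑ i ∈ s, F i) :=
  Finset.sum_induction F (t ≤ gaussValue v χ ·)
    (fun _ _ hf hg ↦ (le_min hf hg).trans min_le_gaussValue_add) le_top ht

theorem gaussValue_add_le_gaussValue_mul :
    gaussValue v χ f + gaussValue v χ g ≤ gaussValue v χ (f * g) := by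
  rw [AddMonoidAlgebra.mul_def]
  refine le_gaussValue_sum fun a _ ↦ le_gaussValue_sum fun b _ ↦ ?_
  calc gaussValue v χ f + gaussValue v χ g
      ≤ gaussTerm v χ f a + gaussTerm v χ g b := add_le_add (gaussValue_le a) (gaussValue_le b)
    _ = gaussValue v χ (AddMonoidAlgebra.single (a + b) (f.coeff a * g.coeff b)) := by
        rw [gaussValue_single, v.map_mul, map_add, WithTop.coe_add, gaussTerm, gaussTerm,
          add_add_add_comm]

theorem expNeg_gaussValue_add_le (f g : AddMonoidAlgebra A G) :
    expNeg (gaussValue v χ (f + g)) ≤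
      max (expNeg (gaussValue v χ f)) (expNeg (gaussValue v χ g)) := by
  rw [← expNeg_strictAnti.antitone.map_min]
  exact expNeg_strictAnti.antitone min_le_gaussValue_add

/-- The Gauss seminorm `f ↦ exp (-gaussValue v χ f)`. -/
def gaussSeminorm (v : AddValuation A (WithTop ℝ)) (χ : G →+ ℝ) :
    RingSeminorm (AddMonoidAlgebra A G) where
  toFun f := expNeg (gaussValue v χ f)
  map_zero' := by rw [gaussValue_zero, expNeg_top]
  neg' f := by rw [gaussValue_neg]
  add_le' f g :=
    (expNeg_gaussValue_add_le f g).trans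
      (max_le_add_of_nonneg (expNeg_nonneg _) (expNeg_nonneg _))
  mul_le' f g :=
    (expNeg_strictAnti.antitone gaussValue_add_le_gaussValue_mul).trans_eq (expNeg_add _ _)

theorem gaussSeminorm_apply : gaussSeminorm v χ f = expNeg (gaussValue v χ f) := rfl

theorem isNonarchimedean_gaussSeminorm : IsNonarchimedean (gaussSeminorm v χ) :=
  expNeg_gaussValue_add_le

/-- The minimum defining the Gauss value of `f` is achieved at least twice. -/
def IsGaussValueAttainedTwice (v : AddValuation A (WithTop ℝ)) (χ : G →+ ℝ)
    (f : AddMonoidAlgebra A G) : Prop :=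
  ∃ h₁ ∈ f.coeff.support, ∃ h₂ ∈ f.coeff.support, h₁ ≠ h₂ ∧
    gaussTerm v χ f h₁ = gaussValue v χ f ∧ gaussTerm v χ f h₂ = gaussValue v χ f

theorem IsGaussValueAttainedTwice.exists_ne (hf : IsGaussValueAttainedTwice v χ f) (h : G) :
    ∃ h' ≠ h, gaussTerm v χ f h' = gaussValue v χ f := by
  obtain ⟨h₁, -, h₂, -, hne, hmin₁, hmin₂⟩ := hf
  rcases eq_or_ne h₁ h with rfl | hne₁
  · exact ⟨h₂, hne.symm, hmin₂⟩
  · exact ⟨h₁, hne₁, hmin₁⟩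

/-- The tropical variety of an ideal of the monoid algebra `A[G]`, as a set of characters of `G`:
the minimum defining the Gauss value is achieved at least twice for each nonzero element. -/
def characterTropVariety (v : AddValuation A (WithTop ℝ)) (J : Ideal (AddMonoidAlgebra A G)) :
    Set (G →+ ℝ) :=
  {χ | ∀ f ∈ J, f ≠ 0 → IsGaussValueAttainedTwice v χ f}

variable {J : Ideal (AddMonoidAlgebra A G)}

theorem gaussValue_nonpos_of_one_sub_mem (hχ : χ ∈ characterTropVariety v J) (hf : 1 - f ∈ J) :
    gaussValue v χ f ≤ 0 := by
  by_contra! hpos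
  have hterm (h : G) : 0 < gaussTerm v χ f h := hpos.trans_le (gaussValue_le h)
  have hzero : gaussTerm v χ (1 - f) 0 = 0 := by
    have hlt : v 1 < v (f.coeff 0) := by simpa [gaussTerm] using hterm 0
    simp [gaussTerm, AddMonoidAlgebra.one_def, v.map_sub_eq_of_lt_left hlt]
  have hne_zero (h : G) (hh : h ≠ 0) : gaussTerm v χ (1 - f) h = gaussTerm v χ f h := by
    simp [gaussTerm, AddMonoidAlgebra.one_def, hh]
  have hne : 1 - f ≠ 0 := by
    intro h
    simp [h, gaussTerm] at hzero
  obtain ⟨h, hh, hmin⟩ := (hχ _ hf hne).exists_ne 0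
  exact (hterm h).not_ge <|
    calc gaussTerm v χ f h = gaussValue v χ (1 - f) := by rw [← hne_zero h hh, hmin]
      _ ≤ gaussTerm v χ (1 - f) 0 := gaussValue_le 0
      _ = 0 := hzero

theorem isUnitalNonarchimedean_quotientSeminorm (hχ : χ ∈ characterTropVariety v J) :
    IsUnitalNonarchimedean (quotientSeminorm (gaussSeminorm v χ) J) := by
  refine ⟨le_antisymm ?_ (le_quotientSeminorm_iff.2 fun f hf ↦ ?_),
    isNonarchimedean_quotientSeminorm isNonarchimedean_gaussSeminorm⟩
  · calc quotientSeminorm (gaussSeminorm v χ) J (Ideal.Quotient.mk J 1)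
        ≤ gaussSeminorm v χ 1 := quotientSeminorm_mk_le 1
      _ = 1 := by rw [gaussSeminorm_apply, gaussValue_one, expNeg_zero]
  · have hmem : 1 - f ∈ J := by
      rw [← Ideal.Quotient.eq_zero_iff_mem, map_sub, map_one, hf, sub_self]
    calc 1 = expNeg 0 := expNeg_zero.symm
      _ ≤ gaussSeminorm v χ f :=
        expNeg_strictAnti.antitone (gaussValue_nonpos_of_one_sub_mem hχ hmem)

end GaussValue

section GroupAlgebra

variable {k : Type*} [Field k] {G : Type*} [AddCommGroup G] {v : AddValuation k (WithTop ℝ)}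
  {χ : G →+ ℝ} {J : Ideal (AddMonoidAlgebra k G)}

theorem mulRingSeminorm_mk_single {p : MulRingSeminorm (AddMonoidAlgebra k G ⧸ J)}
    (hp : ∀ x, p x ≤ quotientSeminorm (gaussSeminorm v χ) J x) (h : G) {a : k} (ha : a ≠ 0) :
    p (Ideal.Quotient.mk J (AddMonoidAlgebra.single h a)) = expNeg (v a + (χ h : ℝ)) := by
  have hle (g : G) (b : k) : p (Ideal.Quotient.mk J (AddMonoidAlgebra.single g b)) ≤
      expNeg (v b + (χ g : ℝ)) := by
    rw [← gaussValue_single]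
    exact (hp _).trans (quotientSeminorm_mk_le _)
  refine mulRingSeminorm_eq_of_le_of_mul_eq_one ?_ (hle h a) (hle (-h) a⁻¹) ?_
  · rw [← map_mul, AddMonoidAlgebra.single_mul_single, add_neg_cancel, mul_inv_cancel₀ ha,
      ← AddMonoidAlgebra.one_def, map_one]
  · rw [← expNeg_add, add_add_add_comm, ← v.map_mul, mul_inv_cancel₀ ha, v.map_one, zero_add,
      ← WithTop.coe_add, ← map_add, add_neg_cancel, map_zero, WithTop.coe_zero, expNeg_zero]

theorem mem_bieriGrovesSet_of_mem_characterTropVariety (hχ : χ ∈ characterTropVariety v J) :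
    χ ∈ bieriGrovesSet v J := by
  obtain ⟨p, hna, hp⟩ := exists_mulRingSeminorm_le (isUnitalNonarchimedean_quotientSeminorm hχ)
  have hsingle (h : G) {a : k} (ha : a ≠ 0) : negLogValuation p hna
      (Ideal.Quotient.mk J (AddMonoidAlgebra.single h a)) = v a + (χ h : ℝ) :=
    (congrArg negLog (mulRingSeminorm_mk_single hp h ha)).trans (negLog_expNeg _)
  refine ⟨negLogValuation p hna, fun a ↦ ?_, fun h ↦ ?_⟩
  · rcases eq_or_ne a 0 with rfl | ha
    · simp
    · simpa using hsingle 0 ha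
  · simpa using hsingle h one_ne_zero

theorem mem_characterTropVariety_of_mem_bieriGrovesSet (hχ : χ ∈ bieriGrovesSet v J) :
    χ ∈ characterTropVariety v J := by
  obtain ⟨w, hwv, hwχ⟩ := hχ
  intro f hf hne
  let F (h : G) := Ideal.Quotient.mk J (AddMonoidAlgebra.single h (f.coeff h))
  have hF (h : G) : w (F h) = gaussTerm v χ f h := by
    rw [gaussTerm, ← hwv, ← hwχ, ← w.map_mul, ← map_mul, AddMonoidAlgebra.single_mul_single,
      zero_add, mul_one]
  have hsum : ∑ h ∈ f.coeff.support, F h = 0 := by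
    have hf_sum : ∑ h ∈ f.coeff.support, AddMonoidAlgebra.single h (f.coeff h) = f :=
      AddMonoidAlgebra.sum_coeff_single f
    rwa [← map_sum, hf_sum, Ideal.Quotient.eq_zero_iff_mem]
  have hsupp : f.coeff.support.Nonempty := by
    rwa [Finsupp.support_nonempty_iff, ne_eq, AddMonoidAlgebra.coeff_eq_zero]
  obtain ⟨h₁, hh₁, hmin⟩ := Finset.exists_mem_eq_inf _ hsupp (gaussTerm v χ f)
  have htop : w (F h₁) ≠ ⊤ := by
    rw [hF, gaussTerm]
    exact WithTop.add_ne_top.2 ⟨v.ne_top_iff.2 (Finsupp.mem_support_iff.1 hh₁), WithTop.coe_ne_top⟩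
  obtain ⟨h₂, hh₂, hh, heq⟩ := exists_ne_map_eq_of_sum_eq_zero w hsum hh₁
    (fun h _ ↦ by rw [hF, hF, ← hmin]; exact gaussValue_le h) htop
  rw [hF, hF] at heq
  exact ⟨h₁, hh₁, h₂, hh₂, hh.symm, hmin.symm, heq.trans hmin.symm⟩

theorem bieriGrovesSet_eq_characterTropVariety (v : AddValuation k (WithTop ℝ))
    (J : Ideal (AddMonoidAlgebra k G)) : bieriGrovesSet v J = characterTropVariety v J :=
  Set.Subset.antisymm (fun _ ↦ mem_characterTropVariety_of_mem_bieriGrovesSet)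
    fun _ ↦ mem_bieriGrovesSet_of_mem_characterTropVariety

variable {H : Type*} [AddCommGroup H] {ψ : G →+ H}

theorem mapDomainRingHom_surjective (hψ : Function.Surjective ψ) :
    Function.Surjective (AddMonoidAlgebra.mapDomainRingHom k ψ) := by
  intro f
  obtain ⟨g, hg⟩ := Finsupp.mapDomain_surjective (M := k) hψ f.coeff
  exact ⟨.ofCoeff g, AddMonoidAlgebra.coeff_injective hg⟩

theorem comp_mem_bieriGrovesSet_comap_iff (hψ : Function.Surjective ψ)
    {I : Ideal (AddMonoidAlgebra k H)} {χ : H →+ ℝ} :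
    χ.comp ψ ∈ bieriGrovesSet v (I.comap (AddMonoidAlgebra.mapDomainRingHom k ψ)) ↔
      χ ∈ bieriGrovesSet v I := by
  let e := RingEquiv.ofBijective
    (Ideal.quotientMap I (AddMonoidAlgebra.mapDomainRingHom k ψ) le_rfl)
    ⟨Ideal.quotientMap_injective, Ideal.quotientMap_surjective (mapDomainRingHom_surjective hψ)⟩
  have he (g : G) (a : k) : e (Ideal.Quotient.mk _ (AddMonoidAlgebra.single g a)) =
      Ideal.Quotient.mk I (AddMonoidAlgebra.single (ψ g) a) := by
    change Ideal.Quotient.mk I (AddMonoidAlgebra.mapDomainRingHom k ψ (.single g a)) = _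
    rw [AddMonoidAlgebra.mapDomainRingHom_apply, AddMonoidAlgebra.mapDomain_single]
  constructor
  · rintro ⟨w, hwv, hwχ⟩
    refine ⟨w.comap e.symm.toRingHom, fun a ↦ ?_, fun h ↦ ?_⟩
    · rw [← hwv a, ← map_zero ψ, ← he]
      exact congrArg w (e.symm_apply_apply _)
    · obtain ⟨g, rfl⟩ := hψ h
      rw [← AddMonoidHom.comp_apply, ← hwχ g, ← he]
      exact congrArg w (e.symm_apply_apply _)
  · rintro ⟨w, hwv, hwχ⟩
    refine ⟨w.comap e.toRingHom, fun a ↦ ?_, fun g ↦ ?_⟩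
    · rw [← hwv a, ← map_zero ψ, ← he]
      rfl
    · rw [AddMonoidHom.comp_apply, ← hwχ (ψ g), ← he]
      rfl

end GroupAlgebra

section Laurent

variable {k : Type*} [Field k] {ι : Type*} [Fintype ι] [DecidableEq ι]
  {v : AddValuation k (WithTop ℝ)}

theorem sum_mul_map_single (χ : (ι → ℤ) →+ ℝ) (u : ι → ℤ) :
    ∑ i, (u i : ℝ) * χ (Pi.single i 1) = χ u := by
  conv_rhs => rw [← Finset.univ_sum_single u, map_sum]
  refine Finset.sum_congr rfl fun i _ ↦ ?_
  rw [← zsmul_eq_mul, ← map_zsmul, ← Pi.single_smul, zsmul_one, Int.cast_id]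

theorem tropTerm_map_single (χ : (ι → ℤ) →+ ℝ) (f : Laurent k ι) :
    tropTerm v f (fun i ↦ χ (Pi.single i 1)) = gaussTerm v χ f := by
  ext u : 1
  rw [tropTerm, sum_mul_map_single, gaussTerm]

theorem map_single_mem_tropVarietyLaurent_iff {χ : (ι → ℤ) →+ ℝ} {J : Ideal (Laurent k ι)} :
    (fun i ↦ χ (Pi.single i 1)) ∈ tropVarietyLaurent v J ↔ χ ∈ characterTropVariety v J := by
  simp only [tropVarietyLaurent, tropHypersurface, tropPoly, Set.mem_iInter, Set.mem_ofPred_eq,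
    tropTerm_map_single]
  rfl

theorem CyclicDecomposition.psi_surjective {H : Type*} [AddCommGroup H]
    (D : CyclicDecomposition H) : Function.Surjective D.psi := by
  intro h
  choose z hz using fun j ↦ ZMod.intCast_surjective ((D.equiv h).2 j)
  exact ⟨Sum.elim (D.equiv h).1 z, D.equiv.symm_apply_eq.2 (Prod.ext rfl (funext hz))⟩

end Laurent

end TropicalBieriGroves

end

open TropicalBieriGroves in
theorem mainTheorem11_general {k : Type*} [Field k] {G H : Type*} [AddCommGroup G] [AddCommGroup H]
    {ψ : G →+ H} (hψ : Function.Surjective ψ) (v : AddValuation k (WithTop ℝ))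
    (I : Ideal (AddMonoidAlgebra k H)) :
    bieriGrovesSet v I =
      {χ | χ.comp ψ ∈
        characterTropVariety v (I.comap (AddMonoidAlgebra.mapDomainRingHom k ψ))} := by
  ext χ
  rw [← comp_mem_bieriGrovesSet_comap_iff hψ, bieriGrovesSet_eq_characterTropVariety,
    Set.mem_ofPred_eq]

theorem mainTheorem11 {k : Type*} [Field k] {H : Type*} [AddCommGroup H] [AddGroup.FG H]
    (hH : 1 ≤ Module.finrank ℤ H) (v : AddValuation k (WithTop ℝ))
    (I : Ideal (AddMonoidAlgebra k H)) (hI : I ≠ ⊤) :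
    ∀ D : TropicalBieriGroves.CyclicDecomposition H,
      TropicalBieriGroves.bieriGrovesSet v I = TropicalBieriGroves.tropVariety D v I := fun D ↦
  (mainTheorem11_general D.psi_surjective v I).trans <|
    Set.ext fun _ ↦ TropicalBieriGroves.map_single_mem_tropVarietyLaurent_iff.symm
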